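/- Let $n\ge 3$, let $e_1=(1,0,\dots,0)\in\mathbb{R}^n$, write $y=(y_1,\dots,y_n)\in\mathbb{R}^n$, and let $|\cdot|$ denote the Euclidean norm of a vector and the Lebesgue measure of a set. Let $B_n=\{y\in\mathbb{R}^n: |y|<1\}$ and $$G_n=\{y\in\mathbb{R}^n:\ y_1>0,\ |y|^n<(2n-4)\,y_1^2\}.$$ For $\theta\in[0,1]$ define $$E(\theta)=\Big\{y\in\mathbb{R}^n\setminus\{\theta e_1\}:\ y_1\ge 0,\ |y-\theta e_1|^{2-n}-|y+\theta e_1|^{2-n}\Big(1+(2n-4)\frac{y_1(y_1+\theta)}{|y+\theta e_1|^2}\Big)>1\Big\},$$ $$D(\theta)=\{y\in\mathbb{R}^n:\ y_1\ge 0,\ |y+\theta e_1|^n\le(2n-4)\,y_1(y_1+\theta)\}.$$ Then for every $\theta\in[0,1]$, $$|E(\theta)\cup D(\theta)|\le\begin{cases}|B_n| & \text{if } n=3 \text{ or } n=4,\\ |G_n| & \text{if } n\ge 5.\end{cases}$$ -/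

import Mathlib

open MeasureTheory

namespace LevelSets

/-- The first standard basis vector of `ℝⁿ` (for `n ≥ 1`). -/
noncomputable def e₁ (n : ℕ) [NeZero n] : EuclideanSpace ℝ (Fin n) :=
  EuclideanSpace.single 0 1

/-- The function `F_θ(y) = |y - θe₁|^{2-n} - |y + θe₁|^{2-n} (1 + (2n-4) y₁(y₁+θ) / |y + θe₁|²)`,
where `y₁` is the first coordinate of `y`; it is meaningful away from `y = ± θe₁`. -/
noncomputable def F (n : ℕ) [NeZero n] (θ : ℝ) (y : EuclideanSpace ℝ (Fin n)) : ℝ :=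
  ‖y - θ • e₁ n‖ ^ (2 - (n : ℤ)) -
    ‖y + θ • e₁ n‖ ^ (2 - (n : ℤ)) *
      (1 + (2 * (n : ℝ) - 4) * (y 0 * (y 0 + θ)) / ‖y + θ • e₁ n‖ ^ 2)

/-- The set `E(θ) = {y : y₁ ≥ 0, F_θ(y) > 1}`. The expression `F_θ` has its pole at `y = θe₁`, which
is excluded explicitly; for `θ ≥ 0`, `y₁ ≥ 0` and `y ≠ θe₁` one has `y ≠ -θe₁`, so no division by
zero occurs on this set. -/
def E (n : ℕ) [NeZero n] (θ : ℝ) : Set (EuclideanSpace ℝ (Fin n)) :=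
  {y | 0 ≤ y 0 ∧ y ≠ θ • e₁ n ∧ 1 < F n θ y}

/-- The set `D(θ) = {y : y₁ ≥ 0, |y + θe₁|ⁿ ≤ (2n-4) y₁ (y₁ + θ)}`. -/
def D (n : ℕ) [NeZero n] (θ : ℝ) : Set (EuclideanSpace ℝ (Fin n)) :=
  {y | 0 ≤ y 0 ∧ ‖y + θ • e₁ n‖ ^ n ≤ (2 * (n : ℝ) - 4) * (y 0 * (y 0 + θ))}

/-- The set `G_n = {y : y₁ > 0, |y|ⁿ < (2n-4) y₁²}`. -/
def G (n : ℕ) [NeZero n] : Set (EuclideanSpace ℝ (Fin n)) :=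
  {y | 0 < y 0 ∧ ‖y‖ ^ n < (2 * (n : ℝ) - 4) * y 0 ^ 2}

/-- The open unit ball `B_n` of `ℝⁿ`. -/
def B (n : ℕ) : Set (EuclideanSpace ℝ (Fin n)) :=
  Metric.ball 0 1

end LevelSets

/-! Write `κ = 2n - 4`, `M = n - 2`, `t = y 0`, `a = |y - θe₁|`, `b = |y + θe₁|`, `s = κθt`; then
`b² = a² + 4θt = a² + 2s/M`. On `E` one always has `a < 1`, so `E` lies in the unit ball about
`θe₁`. The sign of `κθ² - 1` decides how `κt(t + θ)` compares with `s + s²`, and so splits the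
argument.

If `κθ² ≥ 1` and `n ≥ 4`, `D` lies in the same ball (`D_subset_closedBall`), and for `n ≥ 5` that
ball has no more volume than `G n` (`volume_ball_le_volume_G`): polar coordinates and Gaussian
moments express the volume of `G n` through Gamma functions, which log-convexity bounds.

If `κθ² ≤ 1` and `n ≥ 5`, no ball is used. A point of `E \ D` must have `s ≥ 2`
(`two_le_of_mem_E_diff_D`, the analytic core). Translate `D` by `θe₁` and `E \ D` by `-θe₁`, each
preserving volume. The first lands in `shiftedD`, the second in `sector`; on every ray from the
origin their radial measures add up to at most that of `G n` (`slice_add_slice_le`).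

In dimension 4 with `κθ² ≤ 1`, `E ⊆ D` and `D` lies in the unit ball about `(1 - θ)e₁`. In dimension
3 the union lies in the unit ball about `(1 - θ)e₁` or `θe₁`, according to whether `θ ≤ 1/2`. -/

namespace LevelSets

/-! ### Elementary one-variable inequalities -/

/-- Bernoulli's inequality in the form `(1 + z)^N ≥ (1 + N z / j)^j` for `j ≤ N`. -/
theorem one_add_pow_le_pow {N j : ℕ} (hj : 0 < j) (hjN : j ≤ N) {z : ℝ} (hz : -1 ≤ z)
    (hz' : 0 ≤ 1 + (N / j : ℝ) * z) : (1 + (N / j : ℝ) * z) ^ j ≤ (1 + z) ^ N := by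
  have hj' : (0 : ℝ) < j := by exact_mod_cast hj
  have h1 : (1 : ℝ) ≤ N / j := by
    rw [le_div_iff₀ hj']; simpa using (by exact_mod_cast hjN : (j : ℝ) ≤ N)
  have h2 := one_add_mul_self_le_rpow_one_add hz h1
  have h3 : ((1 + z) ^ (N / j : ℝ)) ^ j = (1 + z) ^ N := by
    rw [← Real.rpow_natCast, ← Real.rpow_mul (by linarith), div_mul_cancel₀ _ hj'.ne',
      Real.rpow_natCast]
  rw [← h3]
  exact pow_le_pow_left₀ hz' h2 j

/-- Bernoulli with exponent `N / j`; it replaces a general dimension by a small fixed exponent. -/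
theorem one_sub_div_pow_mono {N j : ℕ} (hj : 0 < j) (hjN : j ≤ N) {x : ℝ} (hx : x ≤ j) :
    (1 - x / j) ^ j ≤ (1 - x / N) ^ N := by
  have hj' : (0 : ℝ) < j := by exact_mod_cast hj
  have hN' : (0 : ℝ) < N := by exact_mod_cast hj.trans_le hjN
  have hjN' : (j : ℝ) ≤ N := by exact_mod_cast hjN
  have e : 1 + (N / j : ℝ) * (-(x / N)) = 1 - x / j := by field_simp; ring
  have h := one_add_pow_le_pow (z := -(x / N)) hj hjN
    (by rw [neg_le_neg_iff, div_le_one hN']; linarith)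
    (by rw [e, sub_nonneg, div_le_one hj']; exact hx)
  rw [e] at h
  simpa [sub_eq_add_neg] using h

/-- Up to `s = 2` the right side dominates `exp (2s)`, and `s + s² < exp s`. Beyond 2 the
exponential bound fails, and growth from the value at `s = 2` is used instead. -/
theorem sq_lt_one_add_div_pow {M : ℕ} (hM : 2 ≤ M) {s : ℝ} (hs : 0 ≤ s) :
    (s + s ^ 2) ^ 2 < (1 + 2 * s / M) ^ (M + 2) := by
  have hM0 : (0 : ℝ) < M := by exact_mod_cast (by omega : 0 < M)
  by_cases h2 : s ≤ 2
  · have h1 : Real.exp (2 * s) ≤ (1 + 2 * s / M) ^ (M + 2) := by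
      have hpos : 0 < 1 + 2 * s / M := by positivity
      rw [← Real.exp_log hpos, ← Real.exp_nat_mul, Real.exp_le_exp]
      have h := Real.le_log_one_add_of_nonneg (x := 2 * s / M) (by positivity)
      have e : 2 * (2 * s / M) / (2 * s / M + 2) = 2 * s / (s + M) := by
        field_simp
      rw [e] at h
      -- Here `(M + 2) / (M + s) ≥ 1`, which is exactly `s ≤ 2`.
      calc 2 * s ≤ (M + 2 : ℝ) * (2 * s / (s + M)) := by
            rw [← mul_div_assoc, le_div_iff₀ (by positivity)]; nlinarith
        _ ≤ _ := by push_cast; gcongr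
    refine lt_of_lt_of_le ?_ h1
    have h3 : 1 + s + s ^ 2 / 2 + s ^ 3 / 6 ≤ Real.exp s := by
      have := Real.sum_le_exp_of_nonneg hs 4
      simp [Finset.sum_range_succ, Nat.factorial] at this
      linarith
    rw [two_mul, Real.exp_add, ← sq]
    have : s + s ^ 2 < Real.exp s := by
      nlinarith [mul_nonneg hs (sq_nonneg (s - 2)), sq_nonneg (s - 2)]
    gcongr
  · push Not at h2
    have hcase : M = 2 ∨ M = 3 ∨ 4 ≤ M := by omega
    rcases hcase with rfl | rfl | hM4
    · have : (1 + 2 * s / (2 : ℕ) : ℝ) = 1 + s := by push_cast; ring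
      rw [this]
      have : s + s ^ 2 < (1 + s) ^ 2 := by nlinarith
      calc (s + s ^ 2) ^ 2 < ((1 + s) ^ 2) ^ 2 := by gcongr
        _ = _ := by ring
    · have hh : (s + s ^ 2) ^ 2 < (1 + 2 * s / 3) ^ 5 := by
        obtain ⟨r, hr, rfl⟩ : ∃ r, 0 ≤ r ∧ s = 2 + r := ⟨s - 2, by linarith, by ring⟩
        have : 0 ≤ r ^ 3 * (r - 2) ^ 2 := by positivity
        have : 0 ≤ r ^ 2 * (r - 2) ^ 2 := by positivity
        have : 0 ≤ r * (r - 2) ^ 2 := by positivity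
        nlinarith [pow_nonneg hr 2, pow_nonneg hr 3, pow_nonneg hr 4, pow_nonneg hr 5]
      exact_mod_cast hh
    · have hM4' : (4 : ℝ) ≤ M := by exact_mod_cast hM4
      obtain ⟨r, hr, rfl⟩ : ∃ r, 0 ≤ r ∧ s = 2 + r := ⟨s - 2, by linarith, by ring⟩
      -- The first factor is the value at `s = 2`, with power at least `exp 4`; Bernoulli reduces
      -- the second to a fourth power, where `M ≥ 4` gives the slope `3/8`.
      have e : 1 + 2 * (2 + r) / M = (1 + 4 / (M : ℝ)) * (1 + 2 * r / (M + 4)) := by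
        field_simp; ring
      rw [e, mul_pow]
      have h1 : Real.exp 4 ≤ (1 + 4 / (M : ℝ)) ^ (M + 2) := by
        have hpos : 0 < 1 + 4 / (M : ℝ) := by positivity
        rw [← Real.exp_log hpos, ← Real.exp_nat_mul, Real.exp_le_exp]
        have h := Real.le_log_one_add_of_nonneg (x := 4 / (M : ℝ)) (by positivity)
        have e : 2 * (4 / (M : ℝ)) / (4 / (M : ℝ) + 2) = 4 / (2 + M) := by
          field_simp; ring
        rw [e] at h
        calc (4 : ℝ) = (M + 2 : ℝ) * (4 / (2 + M)) := by field_simp; ring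
          _ ≤ _ := by push_cast; gcongr
      have h2 : (1 + 3 * r / 8) ^ 4 ≤ (1 + 2 * r / (M + 4 : ℝ)) ^ (M + 2) := by
        have hz : 0 ≤ 2 * r / (M + 4 : ℝ) := by positivity
        have h := one_add_pow_le_pow (N := M + 2) (j := 4) (z := 2 * r / (M + 4 : ℝ)) (by norm_num)
          (by omega) (by linarith) (by positivity)
        refine le_trans ?_ h
        gcongr
        push_cast
        rw [div_mul_div_comm, div_le_div_iff₀ (by norm_num) (by positivity)]
        nlinarith
      have h3 : (7.38 : ℝ) ^ 2 ≤ Real.exp 4 := by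
        have : Real.exp 4 = Real.exp 1 ^ 4 := by rw [← Real.exp_nat_mul]; norm_num
        rw [this]
        have := Real.exp_one_gt_d9
        calc (7.38 : ℝ) ^ 2 ≤ 2.7182818283 ^ 4 := by norm_num
          _ ≤ _ := by gcongr
      calc (2 + r + (2 + r) ^ 2) ^ 2 < (7.38 * (1 + 3 * r / 8) ^ 2) ^ 2 := by
            gcongr
            nlinarith
        _ = 7.38 ^ 2 * (1 + 3 * r / 8) ^ 4 := by ring
        _ ≤ _ := by gcongr; exact h3.trans h1

/-- The difference of the two sides vanishes at 0; divided by `x`, it is a nonnegative combination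
of the Bernstein polynomials of the interval, supplied by `h`. The next five lemmas work the same
way. -/
theorem one_le_sub_pow_three_mul_sq {x : ℝ} (hx : 0 ≤ x) (hx' : x ≤ 0.62) :
    1 ≤ (1 - 2 * x / 3) ^ 3 * (1 + 2 * x) ^ 2 := by
  have h (i j : ℕ) : 0 ≤ x * (x ^ i * (0.62 - x) ^ j) := by
    have : 0 ≤ 0.62 - x := by linarith
    positivity
  linarith [h 0 4, h 1 3, h 2 2, h 3 1, h 4 0]

theorem one_le_sub_pow_three_mul_sq' {x : ℝ} (hx : 0 ≤ x) (hx' : x ≤ 0.95) :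
    1 ≤ (1 - 2 * x / 3) ^ 3 * (1 + 2 * x + 2 * x ^ 2) ^ 2 := by
  have h (i j : ℕ) : 0 ≤ x * (x ^ i * (0.95 - x) ^ j) := by
    have : 0 ≤ 0.95 - x := by linarith
    positivity
  linarith [h 0 6, h 1 5, h 2 4, h 3 3, h 4 2, h 5 1, h 6 0]

theorem one_le_sub_pow_two_mul {x : ℝ} (hx : 0 ≤ x) (hx' : x ≤ 1.11) :
    1 ≤ (1 - x / 2) ^ 2 * (1 + 2 * x + 2 * x ^ 2) := by
  have h (i j : ℕ) : 0 ≤ x * (x ^ i * (1.11 - x) ^ j) := by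
    have : 0 ≤ 1.11 - x := by linarith
    positivity
  linarith [h 0 3, h 1 2, h 2 1, h 3 0]

theorem one_le_sub_pow_five_mul_sq {x : ℝ} (hx : 0 ≤ x) (hx' : x ≤ 1.2) :
    1 ≤ (1 - 2 * x / 5) ^ 5 * (1 + 2 * x + 2 * x ^ 2) ^ 2 := by
  have h (i j : ℕ) : 0 ≤ x * (x ^ i * (1.2 - x) ^ j) := by
    have : 0 ≤ 1.2 - x := by linarith
    positivity
  linarith [h 0 8, h 1 7, h 2 6, h 3 5, h 4 4, h 5 3, h 6 2, h 7 1, h 8 0]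

theorem one_le_sub_pow_three_mul {x : ℝ} (hx : 0 ≤ x) (hx' : x ≤ 1.45) :
    1 ≤ (1 - x / 3) ^ 3 * (1 + 2 * x + 2 * x ^ 2) := by
  have h (i j : ℕ) : 0 ≤ x * (x ^ i * (1.45 - x) ^ j) := by
    have : 0 ≤ 1.45 - x := by linarith
    positivity
  linarith [h 0 4, h 1 3, h 2 2, h 3 1, h 4 0]

theorem one_le_sub_pow_five_mul {x : ℝ} (hx : 0 ≤ x) (hx' : x ≤ 2) :
    1 ≤ (1 - x / 5) ^ 5 * (1 + 2 * x + 2 * x ^ 2) := by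
  have h (i j : ℕ) : 0 ≤ x * (x ^ i * (2 - x) ^ j) := by
    have : 0 ≤ 2 - x := by linarith
    positivity
  linarith [h 0 6, h 1 5, h 2 4, h 3 3, h 4 2, h 5 1, h 6 0]

/-- With `x = s / b²`, the factor `1 - 2x/M` is `a² / b²`, and the last hypothesis is `s + s² ≤
b^(M+2)` rewritten without `b`. The hypothesis keeps `x` small enough that the growing factor
compensates the decaying one. -/
theorem one_le_sub_div_pow_mul_sq {M : ℕ} (hM : 3 ≤ M) {x s : ℝ} (hx : 0 ≤ x) (hs : 0 ≤ s)
    (hs2 : s < 2) (hxM : 2 * x < M) (h : x ^ (M + 2) * (1 + s) ^ 2 ≤ s ^ M) :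
    1 ≤ (1 - 2 * x / M) ^ M * (1 + 2 * x * (1 + s)) ^ 2 := by
  have hM0 : (0 : ℝ) < M := by exact_mod_cast (by omega : 0 < M)
  have hM3 : (3 : ℝ) ≤ M := by exact_mod_cast hM
  have hpos : 0 ≤ 1 - 2 * x / M := by rw [sub_nonneg, div_le_one hM0]; exact hxM.le
  -- The threshold is just above the root of `s(1 + s) = 1`: above it the hypothesis forces `x ≤ s`,
  -- below it `x ≤ 0.62`.
  obtain hs6 | hs6 := le_total s 0.62
  · have hx6 : x ≤ 0.62 := by
      refine le_of_pow_le_pow_left₀ (n := M + 2) (by omega) (by norm_num) ?_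
      have h1 : s ≤ 0.62 ^ 2 * (1 + s) := by linarith
      have h2 : s ^ M ≤ 0.62 ^ (M + 2) * (1 + s) ^ 2 := by
        obtain ⟨k, rfl⟩ := Nat.exists_eq_add_of_le (by omega : 2 ≤ M)
        calc s ^ (2 + k) = s ^ 2 * s ^ k := pow_add _ _ _
          _ ≤ (0.62 ^ 2 * (1 + s)) ^ 2 * 0.62 ^ k := by gcongr
          _ = _ := by ring
      exact le_of_mul_le_mul_right (h.trans h2) (by positivity)
    calc 1 ≤ (1 - 2 * x / 3) ^ 3 * (1 + 2 * x) ^ 2 := one_le_sub_pow_three_mul_sq hx hx6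
      _ ≤ (1 - 2 * x / M) ^ M * (1 + 2 * x * (1 + s)) ^ 2 := by
        gcongr ?_ * ?_ ^ 2
        · exact one_sub_div_pow_mono (j := 3) (by norm_num) hM (x := 2 * x) (by norm_num; linarith)
        · nlinarith
  have hxs : x ≤ s := by
    by_contra! hlt
    have h1 : s ^ M < x ^ M := pow_lt_pow_left₀ hlt hs (by omega)
    have h2 : (1 : ℝ) ≤ (x * (1 + s)) ^ 2 := by
      apply one_le_pow₀; nlinarith
    have h3 : x ^ M * 1 ≤ x ^ M * (x * (1 + s)) ^ 2 := by gcongr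
    have h4 : x ^ M * (x * (1 + s)) ^ 2 = x ^ (M + 2) * (1 + s) ^ 2 := by ring
    linarith
  -- The value of the hypothesis at `s = 2`, since `s^M / (1 + s)²` increases with `s`.
  have hb : x ^ (M + 2) * 9 ≤ 2 ^ M := by
    have h1 : x ^ (M + 2) * (1 + s) ^ 2 * 9 ≤ 2 ^ M * (1 + s) ^ 2 := by
      refine (mul_le_mul_of_nonneg_right h (by norm_num)).trans ?_
      obtain ⟨k, rfl⟩ := Nat.exists_eq_add_of_le (by omega : 2 ≤ M)
      calc s ^ (2 + k) * 9 = (3 * s) ^ 2 * s ^ k := by ring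
        _ ≤ (2 * (1 + s)) ^ 2 * 2 ^ k := by gcongr ?_ ^ 2 * ?_ ^ k; linarith
        _ = _ := by ring
    have h2 : (0 : ℝ) < (1 + s) ^ 2 := by positivity
    nlinarith
  have hxs2 : 1 + 2 * x + 2 * x ^ 2 ≤ 1 + 2 * x * (1 + s) := by nlinarith
  have bound {c : ℝ} (hc : 0 ≤ c) (hc' : 2 ^ M < c ^ (M + 2) * 9) : x ≤ c := by
    by_contra! hlt
    have : c ^ (M + 2) ≤ x ^ (M + 2) := by gcongr
    linarith
  have mono {j : ℕ} {c : ℝ} (hj : 0 < j) (hjM : j ≤ M) (hxc : x ≤ c) (hcj : 2 * c ≤ j) :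
      (1 - 2 * x / j) ^ j ≤ (1 - 2 * x / M) ^ M :=
    one_sub_div_pow_mono hj hjM (by linarith)
  have hcase : M = 3 ∨ M = 4 ∨ M = 5 ∨ M = 6 ∨ M = 7 ∨ M = 8 ∨ M = 9 ∨ 10 ≤ M := by omega
  have hsix (hM6 : 6 ≤ M) (hx' : x ≤ 1.45) :
      1 ≤ (1 - 2 * x / M) ^ M * (1 + 2 * x * (1 + s)) ^ 2 := by
    calc (1 : ℝ) ≤ ((1 - x / 3) ^ 3 * (1 + 2 * x + 2 * x ^ 2)) ^ 2 :=
          one_le_pow₀ (one_le_sub_pow_three_mul hx hx')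
      _ = (1 - 2 * x / (6 : ℕ)) ^ 6 * (1 + 2 * x + 2 * x ^ 2) ^ 2 := by push_cast; ring
      _ ≤ _ := by
        gcongr ?_ * ?_ ^ 2
        exact mono (by norm_num) hM6 hx' (by norm_num)
  rcases hcase with rfl | rfl | rfl | rfl | rfl | rfl | rfl | hM10
  · obtain hx95 | hx95 := le_total x 0.95
    · calc (1 : ℝ) ≤ (1 - 2 * x / 3) ^ 3 * (1 + 2 * x + 2 * x ^ 2) ^ 2 :=
            one_le_sub_pow_three_mul_sq' hx hx95
        _ ≤ _ := by push_cast; gcongr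
    -- The bound `1 + s ≥ 1 + x` is too lossy on this last interval, but such a large `x` forces `s`
    -- close to 2.
    · have hx98 : x ≤ 0.98 := bound (by norm_num) (by norm_num)
      have hs18 : 1.8 ≤ s := by
        by_contra! hlt
        have h5 : (0.95 : ℝ) ^ 5 ≤ x ^ 5 := by gcongr
        have h6 : (0.95 : ℝ) ^ 5 * (1 + s) ^ 2 ≤ s ^ 3 := le_trans (by gcongr) h
        nlinarith [mul_nonneg hs (sub_nonneg.2 hlt.le), mul_nonneg (mul_nonneg hs hs)
          (sub_nonneg.2 hlt.le), mul_nonneg hs (sq_nonneg (1.8 - s))]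
      calc (1 : ℝ) ≤ (1 - 2 * 0.98 / 3) ^ 3 * (1 + 2 * 0.95 * (1 + 1.8)) ^ 2 := by norm_num
        _ ≤ _ := by push_cast; gcongr
  · calc (1 : ℝ) ≤ ((1 - x / 2) ^ 2 * (1 + 2 * x + 2 * x ^ 2)) ^ 2 :=
          one_le_pow₀ (one_le_sub_pow_two_mul hx (bound (by norm_num) (by norm_num)))
      _ = (1 - 2 * x / (4 : ℕ)) ^ 4 * (1 + 2 * x + 2 * x ^ 2) ^ 2 := by push_cast; ring
      _ ≤ _ := by gcongr
  · calc (1 : ℝ) ≤ (1 - 2 * x / 5) ^ 5 * (1 + 2 * x + 2 * x ^ 2) ^ 2 :=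
          one_le_sub_pow_five_mul_sq hx (bound (by norm_num) (by norm_num))
      _ ≤ _ := by push_cast; gcongr
  · exact hsix (by norm_num) (bound (by norm_num) (by norm_num))
  · exact hsix (by norm_num) (bound (by norm_num) (by norm_num))
  · exact hsix (by norm_num) (bound (by norm_num) (by norm_num))
  · exact hsix (by norm_num) (bound (by norm_num) (by norm_num))
  · have hx2 : x ≤ 2 := by linarith
    calc (1 : ℝ) ≤ ((1 - x / 5) ^ 5 * (1 + 2 * x + 2 * x ^ 2)) ^ 2 :=
          one_le_pow₀ (one_le_sub_pow_five_mul hx hx2)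
      _ = (1 - 2 * x / (10 : ℕ)) ^ 10 * (1 + 2 * x + 2 * x ^ 2) ^ 2 := by push_cast; ring
      _ ≤ _ := by
        gcongr ?_ * ?_ ^ 2
        exact mono (by norm_num) hM10 hx2 (by norm_num)

/-! ### Coordinates and first consequences of membership in `E` -/

theorem kappa_pos {n : ℕ} (hn : 3 ≤ n) : 0 < 2 * (n : ℝ) - 4 := by
  have : (3 : ℝ) ≤ n := by exact_mod_cast hn
  linarith

section

variable {n : ℕ} [NeZero n]

theorem norm_add_smul_e₁_sq (y : EuclideanSpace ℝ (Fin n)) (c : ℝ) :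
    ‖y + c • e₁ n‖ ^ 2 = ‖y‖ ^ 2 + 2 * c * y 0 + c ^ 2 := by
  rw [norm_add_sq_real, inner_smul_right, norm_smul]
  simp [e₁, EuclideanSpace.inner_single_right]
  ring

theorem norm_sub_smul_e₁_sq (y : EuclideanSpace ℝ (Fin n)) (c : ℝ) :
    ‖y - c • e₁ n‖ ^ 2 = ‖y‖ ^ 2 - 2 * c * y 0 + c ^ 2 := by
  rw [sub_eq_add_neg, ← neg_smul, norm_add_smul_e₁_sq]; ring

theorem add_smul_e₁_zero (y : EuclideanSpace ℝ (Fin n)) (c : ℝ) :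
    (y + c • e₁ n) 0 = y 0 + c := by simp [e₁]

theorem sub_smul_e₁_zero (y : EuclideanSpace ℝ (Fin n)) (c : ℝ) :
    (y - c • e₁ n) 0 = y 0 - c := by simp [e₁]

theorem apply_zero_le_norm (y : EuclideanSpace ℝ (Fin n)) : y 0 ≤ ‖y‖ :=
  (Real.le_norm_self _).trans (PiLp.norm_apply_le y 0)

theorem norm_add_sq_eq_norm_sub_sq_add (y : EuclideanSpace ℝ (Fin n)) (θ : ℝ) :
    ‖y + θ • e₁ n‖ ^ 2 = ‖y - θ • e₁ n‖ ^ 2 + 4 * θ * y 0 := by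
  rw [norm_add_smul_e₁_sq, norm_sub_smul_e₁_sq]; ring

theorem add_le_norm_add (y : EuclideanSpace ℝ (Fin n)) (θ : ℝ) : y 0 + θ ≤ ‖y + θ • e₁ n‖ := by
  rw [← add_smul_e₁_zero]; exact apply_zero_le_norm _

theorem norm_sub_pos_of_mem_E {θ : ℝ} {y : EuclideanSpace ℝ (Fin n)} (hy : y ∈ E n θ) :
    0 < ‖y - θ • e₁ n‖ :=
  norm_pos_iff.2 (sub_ne_zero.2 hy.2.1)

theorem norm_add_pos_of_mem_E {θ : ℝ} (hθ : 0 ≤ θ) {y : EuclideanSpace ℝ (Fin n)}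
    (hy : y ∈ E n θ) : 0 < ‖y + θ • e₁ n‖ := by
  have h1 := norm_sub_pos_of_mem_E hy
  have h2 := norm_add_sq_eq_norm_sub_sq_add y θ
  have h3 := mul_nonneg hθ hy.1
  refine lt_of_le_of_ne (norm_nonneg _) fun h => ?_
  rw [← h] at h2
  nlinarith

theorem lt_inv_of_mem_E (hn : 3 ≤ n) {θ : ℝ} (hθ : 0 ≤ θ) {y : EuclideanSpace ℝ (Fin n)}
    (hy : y ∈ E n θ) :
    1 + (‖y + θ • e₁ n‖ ^ (n - 2))⁻¹ +
      (2 * (n : ℝ) - 4) * (y 0 * (y 0 + θ)) / ‖y + θ • e₁ n‖ ^ n < (‖y - θ • e₁ n‖ ^ (n - 2))⁻¹ := by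
  have hb := norm_add_pos_of_mem_E hθ hy
  have h := hy.2.2
  unfold F at h
  obtain ⟨M, rfl⟩ := Nat.exists_eq_add_of_le' (by omega : 2 ≤ n)
  have e : (2 : ℤ) - ((M + 2 : ℕ) : ℤ) = -(M : ℤ) := by push_cast; ring
  rw [e, zpow_neg, zpow_neg, zpow_natCast, zpow_natCast] at h
  simp only [Nat.add_sub_cancel]
  rw [pow_add (‖y + θ • e₁ (M + 2)‖)]
  set b := ‖y + θ • e₁ (M + 2)‖
  set Q := (2 * ((M + 2 : ℕ) : ℝ) - 4) * (y 0 * (y 0 + θ))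
  have : Q / (b ^ M * b ^ 2) = (b ^ M)⁻¹ * (Q / b ^ 2) := by field_simp
  rw [this]
  linarith

theorem norm_sub_lt_one_of_mem_E (hn : 3 ≤ n) {θ : ℝ} (hθ : 0 ≤ θ)
    {y : EuclideanSpace ℝ (Fin n)} (hy : y ∈ E n θ) : ‖y - θ • e₁ n‖ < 1 := by
  have h := lt_inv_of_mem_E hn hθ hy
  have ha := norm_sub_pos_of_mem_E hy
  have hk := kappa_pos hn
  have hb := norm_add_pos_of_mem_E hθ hy
  have hQ : 0 ≤ (2 * (n : ℝ) - 4) * (y 0 * (y 0 + θ)) / ‖y + θ • e₁ n‖ ^ n := by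
    have := hy.1
    positivity
  have h1 : 1 < (‖y - θ • e₁ n‖ ^ (n - 2))⁻¹ := by
    have : 0 < (‖y + θ • e₁ n‖ ^ (n - 2))⁻¹ := by positivity
    linarith
  by_contra! hle
  have := inv_le_one_of_one_le₀ (one_le_pow₀ hle (n := n - 2))
  linarith

/-! ### Inclusions in balls -/

/-- If `a > 1` then `b² ≥ 1 + 2s/M`, while membership in `D` and `κθ² ≥ 1` give `b^n ≤ s + s²`;
`sq_lt_one_add_div_pow` forbids both. -/
theorem D_subset_closedBall (hn : 4 ≤ n) {θ : ℝ} (hθ : 0 < θ)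
    (hk : 1 ≤ (2 * (n : ℝ) - 4) * θ ^ 2) : D n θ ⊆ Metric.closedBall (θ • e₁ n) 1 := by
  rintro y ⟨hy0, hy⟩
  rw [mem_closedBall_iff_norm]
  by_contra! ha
  have hκ := kappa_pos (n := n) (by omega)
  have h2 := norm_add_sq_eq_norm_sub_sq_add y θ
  set κ := 2 * (n : ℝ) - 4 with hκdef
  set t := y 0
  set a := ‖y - θ • e₁ n‖
  set b := ‖y + θ • e₁ n‖
  obtain ⟨M, rfl⟩ := Nat.exists_eq_add_of_le' (by omega : 2 ≤ n)
  have hκM : κ = 2 * M := by rw [hκdef]; push_cast; ring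
  have hM0 : (0 : ℝ) < M := by linarith
  have hQ : κ * (t * (t + θ)) ≤ κ * θ * t + (κ * θ * t) ^ 2 := by
    have : 0 ≤ κ * t ^ 2 * (κ * θ ^ 2 - 1) := by
      have : 0 ≤ κ * θ ^ 2 - 1 := by linarith
      positivity
    nlinarith
  have hs : 0 ≤ κ * θ * t := by positivity
  have h1 := sq_lt_one_add_div_pow (M := M) (by omega) hs
  have h3 : 1 + 2 * (κ * θ * t) / M ≤ b ^ 2 := by
    have : 2 * (κ * θ * t) / M = 4 * θ * t := by rw [hκM]; field_simp; ring
    rw [this, h2]; nlinarith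
  have h4 : (1 + 2 * (κ * θ * t) / M) ^ (M + 2) ≤ (b ^ (M + 2)) ^ 2 := by
    rw [← pow_mul, mul_comm (M + 2) 2, pow_mul]
    gcongr
  have h5 : (b ^ (M + 2)) ^ 2 ≤ (κ * θ * t + (κ * θ * t) ^ 2) ^ 2 := by
    have : 0 ≤ b := norm_nonneg _
    gcongr
    exact hy.trans hQ
  linarith

theorem union_subset_closedBall (hn : 4 ≤ n) {θ : ℝ} (hθ : 0 < θ)
    (hk : 1 ≤ (2 * (n : ℝ) - 4) * θ ^ 2) :
    E n θ ∪ D n θ ⊆ Metric.closedBall (θ • e₁ n) 1 := by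
  refine Set.union_subset (fun y hy => ?_) (D_subset_closedBall hn hθ hk)
  rw [mem_closedBall_iff_norm]
  exact (norm_sub_lt_one_of_mem_E (by omega) hθ.le hy).le

/-- The claim is equivalent to `b² ≤ 2(t + θ)`; it follows from `t(t + θ) ≤ (t + θ)²` and `t + θ ≤
b`. -/
theorem D_subset_closedBall_of_le_four (hn : n = 3 ∨ n = 4) {θ : ℝ} (hθ : 0 ≤ θ) :
    D n θ ⊆ Metric.closedBall ((1 - θ) • e₁ n) 1 := by
  rintro y ⟨hy0, hy⟩
  have hb := add_le_norm_add y θ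
  have hb2 := norm_add_smul_e₁_sq y θ
  have hb0 : 0 ≤ ‖y + θ • e₁ n‖ := norm_nonneg _
  have key : ‖y + θ • e₁ n‖ ^ 2 ≤ 2 * (y 0 + θ) := by
    set b := ‖y + θ • e₁ n‖
    by_contra! hlt
    have hbpos : 0 < b := by
      refine lt_of_le_of_ne hb0 fun h => ?_
      rw [← h] at hlt; nlinarith
    have h1 : y 0 * (y 0 + θ) ≤ (y 0 + θ) ^ 2 := by nlinarith
    rcases hn with rfl | rfl
    · norm_num at hy
      nlinarith [mul_lt_mul_of_pos_left hlt hbpos]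
    · norm_num at hy
      nlinarith [mul_pos hbpos hbpos]
  rw [mem_closedBall_iff_norm, ← sq_le_one_iff₀ (norm_nonneg _), norm_sub_smul_e₁_sq]
  nlinarith

/-- The conclusion is membership in the unit ball about `(1 - θ)e₁`. The last hypothesis reads `ab <
b - a`; multiplying by `a + b` gives `a³ < 2θt`. If the conclusion failed, then `θ < 1/8` and `a² >
2θ + 3t/2`, so AM-GM would give `12θt ≤ a⁴ ≤ a³`. -/
theorem sq_le_of_inv_add_one_lt {a b t θ : ℝ} (ha : 0 < a) (hb : 0 < b) (ht : 0 ≤ t) (hθ : 0 ≤ θ)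
    (hθ' : θ ≤ 1 / 2) (hab : b ^ 2 = a ^ 2 + 4 * θ * t) (ha1 : a < 1) (h : 1 + b⁻¹ < a⁻¹) :
    a ^ 2 ≤ 2 * θ + 2 * t * (1 - 2 * θ) := by
  by_contra! hlt
  have hθt := mul_nonneg hθ ht
  have hle : a ≤ b := by nlinarith
  have h1 : a * b < b - a := by
    have h := mul_lt_mul_of_pos_right h (mul_pos ha hb)
    field_simp at h
    linarith
  have h2 : a ^ 3 < 2 * (θ * t) := by
    have h3 : (b - a) * (b + a) = 4 * (θ * t) := by linarith
    have h4 : a * b * (b + a) < 4 * (θ * t) := by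
      rw [← h3]; exact mul_lt_mul_of_pos_right h1 (by linarith)
    have h5 : 2 * a ^ 3 ≤ a * b * (b + a) := by
      have : a * a ≤ a * b := by gcongr
      nlinarith
    linarith
  have hθ2 : θ < 1 / 2 := by
    refine lt_of_le_of_ne hθ' fun h => ?_
    rw [h] at hlt; nlinarith
  have ht2 : t < 1 / 2 := by
    by_contra! h
    nlinarith
  have hθa : 2 * θ < a ^ 2 := by nlinarith
  have hθ8 : θ < 1 / 8 := by
    by_contra! h
    have h3 : a ^ 3 < θ := by nlinarith
    have h4 : 1 / 2 < a := by nlinarith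
    nlinarith
  have h6 : 2 * θ + 3 / 2 * t < a ^ 2 := by nlinarith
  have h7 : 12 * (θ * t) ≤ a ^ 4 := by
    have : (2 * θ + 3 / 2 * t) ^ 2 ≤ (a ^ 2) ^ 2 := by gcongr
    nlinarith [sq_nonneg (2 * θ - 3 / 2 * t)]
  have h8 : a ^ 4 ≤ a ^ 3 := pow_le_pow_of_le_one ha.le ha1.le (by norm_num)
  nlinarith [pow_pos ha 3]

theorem union_subset_closedBall_three {θ : ℝ} (hθ : 0 ≤ θ) :
    ∃ c : EuclideanSpace ℝ (Fin 3), E 3 θ ∪ D 3 θ ⊆ Metric.closedBall c 1 := by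
  obtain hθ2 | hθ2 := le_total θ (1 / 2)
  · refine ⟨(1 - θ) • e₁ 3, Set.union_subset (fun y hy => ?_)
      (D_subset_closedBall_of_le_four (Or.inl rfl) hθ)⟩
    have h := lt_inv_of_mem_E le_rfl hθ hy
    have hb := norm_add_pos_of_mem_E hθ hy
    have h' : 1 + ‖y + θ • e₁ 3‖⁻¹ < ‖y - θ • e₁ 3‖⁻¹ := by
      have : 0 ≤ (2 * ((3 : ℕ) : ℝ) - 4) * (y 0 * (y 0 + θ)) / ‖y + θ • e₁ 3‖ ^ 3 := by
        have := hy.1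
        have := kappa_pos (n := 3) le_rfl
        positivity
      norm_num at h this
      linarith
    have key := sq_le_of_inv_add_one_lt (norm_sub_pos_of_mem_E hy) hb hy.1 hθ hθ2
      (norm_add_sq_eq_norm_sub_sq_add y θ) (norm_sub_lt_one_of_mem_E le_rfl hθ hy) h'
    rw [norm_sub_smul_e₁_sq] at key
    rw [mem_closedBall_iff_norm, ← sq_le_one_iff₀ (norm_nonneg _), norm_sub_smul_e₁_sq]
    nlinarith
  · refine ⟨θ • e₁ 3, Set.union_subset (fun y hy => ?_) ?_⟩
    · rw [mem_closedBall_iff_norm]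
      exact (norm_sub_lt_one_of_mem_E le_rfl hθ hy).le
    · refine fun y hy => ?_
      obtain ⟨ht, h⟩ := hy
      have hab := norm_add_sq_eq_norm_sub_sq_add y θ
      have hb := add_le_norm_add y θ
      rw [mem_closedBall_iff_norm, ← sq_le_one_iff₀ (norm_nonneg _)]
      norm_num at h
      set b := ‖y + θ • e₁ 3‖
      have hb0 : 0 < b := by linarith
      -- Since `t + θ ≤ b`, this yields `b² ≤ 2t ≤ 4θt`, and then `a² = b² - 4θt ≤ 0`.
      have h1 : b ^ 2 * b ≤ 2 * y 0 * b := by nlinarith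
      have h2 := le_of_mul_le_mul_right h1 hb0
      nlinarith

/-- With `A = a²` and `B = b² = A + s`, a point of `E \ D` satisfies `A(B² + s + s²) < sB` and `s <
A(B + s)`. Multiplying them gives `1 + s < B`, that is `A > 1`. -/
theorem E_subset_D_four {θ : ℝ} (hθ : 0 ≤ θ) (hk : 4 * θ ^ 2 ≤ 1) : E 4 θ ⊆ D 4 θ := by
  intro y hy
  refine ⟨hy.1, ?_⟩
  by_contra! hQ
  have h := lt_inv_of_mem_E (by norm_num) hθ hy
  have hb := norm_add_pos_of_mem_E hθ hy
  have ha := norm_sub_pos_of_mem_E hy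
  have ha1 := norm_sub_lt_one_of_mem_E (by norm_num) hθ hy
  have hab := norm_add_sq_eq_norm_sub_sq_add y θ
  have ht := hy.1
  norm_num at h hQ
  set t := y 0
  set a := ‖y - θ • e₁ 4‖
  set b := ‖y + θ • e₁ 4‖
  obtain ⟨s, hs⟩ : ∃ s, s = 4 * θ * t := ⟨_, rfl⟩
  have hs0 : 0 ≤ s := by rw [hs]; positivity
  have hQs : s + s ^ 2 ≤ 4 * (t * (t + θ)) := by
    have : 0 ≤ t ^ 2 * (1 - 4 * θ ^ 2) := by
      have : 0 ≤ 1 - 4 * θ ^ 2 := by linarith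
      positivity
    rw [hs]; nlinarith
  obtain ⟨A, hA⟩ : ∃ A, A = a ^ 2 := ⟨_, rfl⟩
  obtain ⟨B, hB⟩ : ∃ B, B = b ^ 2 := ⟨_, rfl⟩
  have hB4 : b ^ 4 = B ^ 2 := by rw [hB]; ring
  rw [hB4, ← hB, ← hA] at h
  rw [hB4] at hQ
  rw [← hB, ← hA, ← hs] at hab
  have hA0 : 0 < A := by rw [hA]; positivity
  have hB0 : 0 < B := by rw [hB]; positivity
  have hA1 : A < 1 := by rw [hA]; nlinarith
  have h1 : 1 + B⁻¹ + (s + s ^ 2) / B ^ 2 < A⁻¹ := lt_of_le_of_lt (by gcongr) h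
  have h2 : (B ^ 2 + (s + s ^ 2)) * A < s * B := by
    have h := mul_lt_mul_of_pos_right h1 (by positivity : 0 < A * B ^ 2)
    field_simp at h
    nlinarith
  have h3 : s + s ^ 2 < B ^ 2 := lt_of_le_of_lt hQs hQ
  have h4 : s < A * (B + s) := by rw [hab] at h3 ⊢; nlinarith
  have hs' : 0 < s := by
    by_contra! h0
    have : s = 0 := le_antisymm h0 hs0
    rw [this] at h2
    have : 0 < B ^ 2 * A := by positivity
    nlinarith
  have h5 : (B ^ 2 + (s + s ^ 2)) * s < s * B * (B + s) := by
    calc _ ≤ (B ^ 2 + (s + s ^ 2)) * (A * (B + s)) := by gcongr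
      _ = (B ^ 2 + (s + s ^ 2)) * A * (B + s) := by ring
      _ < _ := by gcongr
  have h6 : B ^ 2 + (s + s ^ 2) < B * (B + s) := by nlinarith
  nlinarith

/-! ### The part of `E` outside `D` -/

/-- With `x = s / b²`, lying outside `D` gives `x(1 + s) ≤ b^M`, so membership in `E` yields `a^M (1
+ 2x(1 + s)) < b^M`. For `s < 2` this contradicts `one_le_sub_div_pow_mul_sq`. -/
theorem two_le_of_mem_E_diff_D (hn : 5 ≤ n) {θ : ℝ} (hθ : 0 ≤ θ)
    (hk : (2 * (n : ℝ) - 4) * θ ^ 2 ≤ 1) {y : EuclideanSpace ℝ (Fin n)} (hy : y ∈ E n θ)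
    (hyD : y ∉ D n θ) : 2 ≤ (2 * (n : ℝ) - 4) * θ * y 0 := by
  by_contra! hs2
  have hQ : (2 * (n : ℝ) - 4) * (y 0 * (y 0 + θ)) < ‖y + θ • e₁ n‖ ^ n := by
    by_contra! h
    exact hyD ⟨hy.1, h⟩
  have h := lt_inv_of_mem_E (by omega) hθ hy
  have hb := norm_add_pos_of_mem_E hθ hy
  have ha := norm_sub_pos_of_mem_E hy
  have hab := norm_add_sq_eq_norm_sub_sq_add y θ
  have ht := hy.1
  have hκ := kappa_pos (n := n) (by omega)
  set κ := 2 * (n : ℝ) - 4 with hκdef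
  set t := y 0
  set a := ‖y - θ • e₁ n‖
  set b := ‖y + θ • e₁ n‖
  obtain ⟨M, rfl⟩ := Nat.exists_eq_add_of_le' (by omega : 2 ≤ n)
  have hκM : κ = 2 * M := by rw [hκdef]; push_cast; ring
  have hM0 : (0 : ℝ) < M := by linarith
  simp only [Nat.add_sub_cancel] at h
  obtain ⟨s, hs⟩ : ∃ s, s = κ * θ * t := ⟨_, rfl⟩
  have hs0 : 0 ≤ s := by rw [hs]; positivity
  have hQs : s + s ^ 2 ≤ κ * (t * (t + θ)) := by
    have : 0 ≤ κ * t ^ 2 * (1 - κ * θ ^ 2) := by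
      have : 0 ≤ 1 - κ * θ ^ 2 := by linarith
      positivity
    rw [hs]; nlinarith
  rw [← hs] at hs2
  have hab' : b ^ 2 = a ^ 2 + 2 * s / M := by
    rw [hab, hs, hκM]; field_simp; ring
  obtain ⟨x, hx⟩ : ∃ x, x = s / b ^ 2 := ⟨_, rfl⟩
  have hx0 : 0 ≤ x := by rw [hx]; positivity
  have hsx : s = x * b ^ 2 := by rw [hx]; field_simp
  have hq : a ^ 2 / b ^ 2 = 1 - 2 * x / M := by
    rw [div_eq_iff (by positivity), eq_sub_of_add_eq hab'.symm, hsx]; ring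
  have hxM : 2 * x < M := by
    have : 0 < 1 - 2 * x / M := by rw [← hq]; positivity
    rwa [sub_pos, div_lt_one hM0] at this
  have hbs : s + s ^ 2 ≤ b ^ (M + 2) := hQs.trans hQ.le
  have key := one_le_sub_div_pow_mul_sq (by omega : 3 ≤ M) hx0 hs0 hs2 hxM (by
    have h1 : (s + s ^ 2) ^ 2 ≤ (b ^ (M + 2)) ^ 2 := by gcongr
    have h2 : x ^ (M + 2) * (s + s ^ 2) ^ 2 ≤ s ^ (M + 2) := by
      calc x ^ (M + 2) * (s + s ^ 2) ^ 2 ≤ x ^ (M + 2) * (b ^ (M + 2)) ^ 2 := by gcongr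
        _ = s ^ (M + 2) := by rw [hsx, mul_pow]; ring
    obtain h0 | h0 := hs0.eq_or_lt
    · have : x = 0 := by rw [hx, ← h0, zero_div]
      rw [this, zero_pow (by omega), zero_mul]; positivity
    · have h3 : s ^ 2 * (x ^ (M + 2) * (1 + s) ^ 2) ≤ s ^ 2 * s ^ M := by
        calc _ = x ^ (M + 2) * (s + s ^ 2) ^ 2 := by ring
          _ ≤ _ := h2
          _ = _ := by ring
      exact le_of_mul_le_mul_left h3 (by positivity))
  rw [← hq, div_pow, div_mul_eq_mul_div, one_le_div (by positivity), ← pow_mul, ← pow_mul,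
    mul_comm 2 M, pow_mul, pow_mul, ← mul_pow] at key
  have key' : b ^ M ≤ a ^ M * (1 + 2 * x * (1 + s)) :=
    le_of_pow_le_pow_left₀ two_ne_zero (by positivity) key
  have h1 : 1 + (b ^ M)⁻¹ + (s + s ^ 2) / b ^ (M + 2) < (a ^ M)⁻¹ :=
    lt_of_le_of_lt (by gcongr) h
  have e1 : (s + s ^ 2) / b ^ (M + 2) = x * (1 + s) / b ^ M := by
    rw [hx, pow_add]; field_simp
  have h2 : x * (1 + s) ≤ b ^ M := by
    have h3 : x * (1 + s) * b ^ 2 ≤ b ^ M * b ^ 2 := by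
      calc _ = s + s ^ 2 := by rw [mul_right_comm, ← hsx]; ring
        _ ≤ _ := hbs
        _ = _ := pow_add _ _ _
    exact le_of_mul_le_mul_right h3 (by positivity)
  rw [e1] at h1
  have h4 := mul_lt_mul_of_pos_right h1 (by positivity : 0 < a ^ M * b ^ M)
  have e2 : (1 + (b ^ M)⁻¹ + x * (1 + s) / b ^ M) * (a ^ M * b ^ M) =
      a ^ M * (b ^ M + 1 + x * (1 + s)) := by field_simp
  have e3 : (a ^ M)⁻¹ * (a ^ M * b ^ M) = b ^ M := by field_simp
  rw [e2, e3] at h4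
  have h5 : a ^ M * (1 + 2 * x * (1 + s)) ≤ a ^ M * (b ^ M + 1 + x * (1 + s)) := by
    gcongr ?_ * ?_
    linarith
  linarith

end

/-! ### Volumes as integrals of radial measures over the sphere -/

section Polar

open Measure Module

variable {E : Type*} [NormedAddCommGroup E] [NormedSpace ℝ E] [MeasurableSpace E] [BorelSpace E]
  [FiniteDimensional ℝ E]

theorem measure_eq_lintegral_toSphere [Nontrivial E] (μ : Measure E) [μ.IsAddHaarMeasure] {S : Set E}
    (hS : MeasurableSet S) :
    μ S = ∫⁻ ω, volumeIoiPow (finrank ℝ E - 1) {r | r.1 • ω.1 ∈ S} ∂μ.toSphere := by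
  have hm : Measurable fun p : Metric.sphere (0 : E) 1 × Set.Ioi (0 : ℝ) => p.2.1 • p.1.1 := by
    fun_prop
  have h1 := (μ.measurePreserving_homeomorphUnitSphereProd).measure_preimage
    (hm hS).nullMeasurableSet
  rw [Measure.prod_apply (hm hS)] at h1
  have h2 : (homeomorphUnitSphereProd E) ⁻¹' ((fun p : Metric.sphere (0 : E) 1 ×
      Set.Ioi (0 : ℝ) => p.2.1 • p.1.1) ⁻¹' S) = Subtype.val ⁻¹' S := by
    ext x
    simp only [Set.mem_preimage, homeomorphUnitSphereProd_apply_fst_coe,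
      homeomorphUnitSphereProd_apply_snd_coe]
    rw [smul_smul, mul_inv_cancel₀ (norm_ne_zero_iff.2 x.2), one_smul]
  rw [h2, comap_subtype_coe_apply (measurableSet_singleton _).compl,
    Subtype.image_preimage_coe] at h1
  have h3 : μ ({0}ᶜ ∩ S) = μ S := by
    rw [Set.inter_comm, ← Set.sdiff_eq, measure_sdiff_null (measure_singleton _)]
  rw [← h3, h1]
  rfl

theorem measurable_volumeIoiPow_slice (k : ℕ) {S : Set E} (hS : MeasurableSet S) :
    Measurable fun ω : Metric.sphere (0 : E) 1 => volumeIoiPow k {r | r.1 • ω.1 ∈ S} := by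
  have hm : Measurable fun p : Metric.sphere (0 : E) 1 × Set.Ioi (0 : ℝ) => p.2.1 • p.1.1 := by
    fun_prop
  exact measurable_measure_prodMk_left (hm hS)

theorem volumeIoiPow_singleton (k : ℕ) (x : Set.Ioi (0 : ℝ)) : volumeIoiPow k {x} = 0 := by
  refine withDensity_absolutelyContinuous _ _ ?_
  rw [comap_subtype_coe_apply measurableSet_Ioi, Set.image_singleton, Real.volume_singleton]

theorem volumeIoiPow_le (k : ℕ) {T : Set (Set.Ioi (0 : ℝ))} {c : ℝ}
    (h : ∀ r ∈ T, r.1 ^ (k + 1) ≤ c) : volumeIoiPow k T ≤ ENNReal.ofReal (c / (k + 1)) := by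
  obtain rfl | ⟨r₀, hr₀⟩ := T.eq_empty_or_nonempty
  · simp
  have hc : 0 < c := (pow_pos r₀.2 _).trans_le (h r₀ hr₀)
  have hρ : 0 < c ^ ((k + 1 : ℕ) : ℝ)⁻¹ := Real.rpow_pos_of_pos hc _
  have hρc : (c ^ ((k + 1 : ℕ) : ℝ)⁻¹) ^ (k + 1) = c :=
    Real.rpow_inv_natCast_pow hc.le (by omega)
  set ρ : Set.Ioi (0 : ℝ) := ⟨c ^ ((k + 1 : ℕ) : ℝ)⁻¹, hρ⟩
  have hT : T ⊆ Set.Iio ρ ∪ {ρ} := by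
    intro r hr
    have : r ≤ ρ := by
      have h1 := h r hr
      rw [← hρc] at h1
      exact le_of_pow_le_pow_left₀ (M₀ := ℝ) (n := k + 1) (by omega) hρ.le h1
    rcases this.lt_or_eq with h | h
    · exact Or.inl h
    · exact Or.inr h
  calc volumeIoiPow k T ≤ volumeIoiPow k (Set.Iio ρ) + volumeIoiPow k {ρ} :=
        (measure_mono hT).trans (measure_union_le _ _)
    _ = ENNReal.ofReal (c / (k + 1)) := by
        rw [volumeIoiPow_singleton, add_zero, volumeIoiPow_apply_Iio, hρc]

theorem volumeIoiPow_setOf_pow_lt (k : ℕ) {R : ℝ} (hR : 0 < R) :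
    volumeIoiPow k {r | r.1 < R} = ENNReal.ofReal (R ^ (k + 1) / (k + 1)) :=
  volumeIoiPow_apply_Iio k ⟨R, hR⟩

end Polar

/-! ### Comparison of `shiftedD`, `sector` and `G` ray by ray -/

section

variable {n : ℕ}

theorem norm_smul_sphere (ω : Metric.sphere (0 : EuclideanSpace ℝ (Fin n)) 1)
    (r : Set.Ioi (0 : ℝ)) : ‖r.1 • ω.1‖ = r.1 := by
  have h1 : ‖ω.1‖ = 1 := by simp
  have h2 : (0 : ℝ) < r.1 := r.2
  rw [norm_smul, h1, mul_one, Real.norm_eq_abs, abs_of_pos h2]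

theorem volume_eq_lintegral_slice (hn : 3 ≤ n) {S : Set (EuclideanSpace ℝ (Fin n))}
    (hS : MeasurableSet S) :
    volume S = ∫⁻ ω, Measure.volumeIoiPow (n - 1) {r | r.1 • ω.1 ∈ S}
      ∂(volume : Measure (EuclideanSpace ℝ (Fin n))).toSphere := by
  have : Nontrivial (EuclideanSpace ℝ (Fin n)) :=
    Module.nontrivial_of_finrank_pos (R := ℝ) (by rw [finrank_euclideanSpace_fin]; omega)
  rw [measure_eq_lintegral_toSphere volume hS, finrank_euclideanSpace_fin]

/-- The radius of `G n` in a direction with first coordinate `c`. -/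
noncomputable def radius (n : ℕ) (c : ℝ) : ℝ := ((2 * (n : ℝ) - 4) * c ^ 2) ^ ((n - 2 : ℕ) : ℝ)⁻¹

theorem radius_pow (hn : 3 ≤ n) (c : ℝ) : radius n c ^ (n - 2) = (2 * (n : ℝ) - 4) * c ^ 2 :=
  Real.rpow_inv_natCast_pow (mul_nonneg (kappa_pos hn).le (sq_nonneg c)) (by omega)

theorem radius_pos (hn : 3 ≤ n) {c : ℝ} (hc : 0 < c) : 0 < radius n c :=
  Real.rpow_pos_of_pos (mul_pos (kappa_pos hn) (by positivity)) _

variable [NeZero n]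

theorem measurableSet_G : MeasurableSet (G n) := by
  rw [G, Set.ofPred_and]
  apply MeasurableSet.inter
  · exact measurableSet_lt (by fun_prop) (by fun_prop)
  · exact measurableSet_lt (by fun_prop) (by fun_prop)

theorem slice_G (hn : 3 ≤ n) (ω : Metric.sphere (0 : EuclideanSpace ℝ (Fin n)) 1) :
    {r : Set.Ioi (0 : ℝ) | r.1 • ω.1 ∈ G n} =
      if 0 < ω.1 0 then {r : Set.Ioi (0 : ℝ) | r.1 < radius n (ω.1 0)} else ∅ := by
  ext r
  have hr : (0 : ℝ) < r.1 := r.2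
  simp only [Set.mem_ofPred_eq, G, norm_smul_sphere, PiLp.smul_apply, smul_eq_mul]
  split_ifs with hω
  · have hR := radius_pos hn hω
    simp only [Set.mem_ofPred_eq, mul_pos_iff_of_pos_left hr, hω, true_and]
    have e1 : r.1 ^ n = r.1 ^ (n - 2) * r.1 ^ 2 := by rw [← pow_add]; congr 1; omega
    have e2 : (2 * (n : ℝ) - 4) * (r.1 * ω.1 0) ^ 2 = radius n (ω.1 0) ^ (n - 2) * r.1 ^ 2 := by
      rw [radius_pow hn]; ring
    rw [e1, e2, mul_lt_mul_iff_left₀ (by positivity), pow_lt_pow_iff_left₀ hr.le hR.le (by omega)]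
  · simp [mul_pos_iff_of_pos_left hr, hω]

theorem volumeIoiPow_slice_G (hn : 3 ≤ n) (ω : Metric.sphere (0 : EuclideanSpace ℝ (Fin n)) 1) :
    Measure.volumeIoiPow (n - 1) {r : Set.Ioi (0 : ℝ) | r.1 • ω.1 ∈ G n} =
      if 0 < ω.1 0 then ENNReal.ofReal (radius n (ω.1 0) ^ n / n) else 0 := by
  rw [slice_G hn]
  split_ifs with hω
  · rw [volumeIoiPow_setOf_pow_lt _ (radius_pos hn hω), Nat.sub_add_cancel (by omega),
      Nat.cast_pred (by omega), sub_add_cancel]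
  · simp

/-- The translate `D n θ + θ e₁`. -/
def shiftedD (n : ℕ) [NeZero n] (θ : ℝ) : Set (EuclideanSpace ℝ (Fin n)) :=
  {z | θ ≤ z 0 ∧ ‖z‖ ^ n ≤ (2 * (n : ℝ) - 4) * ((z 0 - θ) * z 0)}

/-- A sector of the unit ball that contains `E n θ \ D n θ - θ e₁` for small `θ`. -/
def sector (n : ℕ) [NeZero n] (θ : ℝ) : Set (EuclideanSpace ℝ (Fin n)) :=
  {w | 0 < w 0 ∧ ‖w‖ < 1 ∧ ‖w‖ ≤ (2 * (n : ℝ) - 4) * θ * w 0 ∧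
    ‖w‖ ^ 2 ≤ (2 * (n : ℝ) - 4) * w 0 ^ 2}

theorem measurableSet_shiftedD (θ : ℝ) : MeasurableSet (shiftedD n θ) := by
  rw [shiftedD, Set.ofPred_and]
  apply MeasurableSet.inter
  · exact measurableSet_le (by fun_prop) (by fun_prop)
  · exact measurableSet_le (by fun_prop) (by fun_prop)

theorem measurableSet_sector (θ : ℝ) : MeasurableSet (sector n θ) := by
  simp only [sector, Set.ofPred_and]
  refine MeasurableSet.inter ?_ (MeasurableSet.inter ?_ (MeasurableSet.inter ?_ ?_))
  · exact measurableSet_lt (by fun_prop) (by fun_prop)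
  · exact measurableSet_lt (by fun_prop) (by fun_prop)
  · exact measurableSet_le (by fun_prop) (by fun_prop)
  · exact measurableSet_le (by fun_prop) (by fun_prop)

theorem volume_D (θ : ℝ) : volume (D n θ) = volume (shiftedD n θ) := by
  rw [← measure_preimage_add_right volume (θ • e₁ n) (shiftedD n θ)]
  congr 1
  ext y
  simp only [D, shiftedD, Set.mem_preimage, Set.mem_ofPred_eq, add_smul_e₁_zero]
  simp

/-- Multiplying the hypothesis by `R / r` gives `R r^(n-1) + R ≤ R^(n-1) r`; adding `(R - r)(R^(n-1)
+ r^(n-1)) ≥ 0` leaves `r^n + R ≤ R^n`. -/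
theorem pow_add_one_le_pow {R r : ℝ} (hn : 3 ≤ n) (hr : 0 < r) (hrR : r ≤ R) (hR : 1 ≤ R)
    (h : r ^ n + r ≤ R ^ (n - 2) * r ^ 2) : r ^ n + 1 ≤ R ^ n := by
  obtain ⟨M, rfl⟩ := Nat.exists_eq_add_of_le' (by omega : 2 ≤ n)
  simp only [Nat.add_sub_cancel] at h
  have h1 : r ^ (M + 1) + 1 ≤ R ^ M * r := by
    refine le_of_mul_le_mul_right ?_ hr
    calc _ = r ^ (M + 2) + r := by ring
      _ ≤ _ := h
      _ = _ := by ring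
  have h2 : 0 ≤ (R - r) * (R ^ (M + 1) + r ^ (M + 1)) := by
    have : 0 ≤ R - r := by linarith
    positivity
  have h3 : (r ^ (M + 1) + 1) * R ≤ R ^ M * r * R := by gcongr
  have e1 : R ^ M * r * R = R ^ (M + 1) * r := by ring
  have e2 : (R - r) * (R ^ (M + 1) + r ^ (M + 1)) =
      R ^ (M + 2) - r ^ (M + 2) - R ^ (M + 1) * r + r ^ (M + 1) * R := by ring
  linarith

/-- A radius `r` contributes `r^n / n`, so on a ray meeting `sector` the set `shiftedD` must leave
room for `1 / n` below `R^n / n`; `pow_add_one_le_pow` provides it. -/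
theorem slice_add_slice_le (hn : 3 ≤ n) {θ : ℝ} (hθ : 0 ≤ θ)
    (ω : Metric.sphere (0 : EuclideanSpace ℝ (Fin n)) 1) :
    Measure.volumeIoiPow (n - 1) {r : Set.Ioi (0 : ℝ) | r.1 • ω.1 ∈ shiftedD n θ} +
      Measure.volumeIoiPow (n - 1) {r : Set.Ioi (0 : ℝ) | r.1 • ω.1 ∈ sector n θ} ≤
    Measure.volumeIoiPow (n - 1) {r : Set.Ioi (0 : ℝ) | r.1 • ω.1 ∈ G n} := by
  have hκ := kappa_pos hn
  have hn1 : n - 1 + 1 = n := by omega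
  have hcast : ((n - 1 : ℕ) : ℝ) + 1 = n := by rw [Nat.cast_pred (by omega), sub_add_cancel]
  have hn0 : (0 : ℝ) < n := by exact_mod_cast (by omega : 0 < n)
  rw [volumeIoiPow_slice_G hn]
  obtain ⟨c, hc⟩ : ∃ c, c = ω.1 0 := ⟨_, rfl⟩
  have hDr (r : Set.Ioi (0 : ℝ)) (h : r.1 • ω.1 ∈ shiftedD n θ) :
      0 < c ∧ r.1 ^ n + (2 * (n : ℝ) - 4) * θ * c * r.1 ≤ radius n c ^ (n - 2) * r.1 ^ 2 := by
    have hr : (0 : ℝ) < r.1 := r.2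
    obtain ⟨h1, h2⟩ := h
    rw [norm_smul_sphere] at h2
    simp only [PiLp.smul_apply, smul_eq_mul, ← hc] at h1 h2
    refine ⟨?_, ?_⟩
    · have h3 : 0 ≤ c := by
        by_contra! h
        have := mul_neg_of_pos_of_neg hr h
        linarith
      refine lt_of_le_of_ne h3 fun h => ?_
      rw [← h, mul_zero, mul_zero, mul_zero] at h2
      have := pow_pos hr n
      linarith
    · rw [radius_pow hn]
      linarith
  have hrR (r : Set.Ioi (0 : ℝ)) (h : r.1 • ω.1 ∈ shiftedD n θ) : r.1 ≤ radius n c := by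
    have hr : (0 : ℝ) < r.1 := r.2
    obtain ⟨h1, h2⟩ := hDr r h
    have h3 : r.1 ^ (n - 2) * r.1 ^ 2 ≤ radius n c ^ (n - 2) * r.1 ^ 2 := by
      rw [← pow_add, Nat.sub_add_cancel (by omega : 2 ≤ n)]
      have : 0 ≤ (2 * (n : ℝ) - 4) * θ * c * r.1 := by positivity
      linarith
    exact le_of_pow_le_pow_left₀ (by omega) (radius_pos hn h1).le
      (le_of_mul_le_mul_right h3 (by positivity))
  -- These are the conditions for the ray to meet `sector`: the second turns the term `κθcr` of
  -- `hDr` into at least `r`, the third says `R ≥ 1`.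
  by_cases hcase : 0 < c ∧ 1 ≤ (2 * (n : ℝ) - 4) * θ * c ∧ 1 ≤ (2 * (n : ℝ) - 4) * c ^ 2
  · obtain ⟨hc0, hc1, hc2⟩ := hcase
    have hR1 : 1 ≤ radius n c := by
      rw [← radius_pow hn] at hc2
      by_contra! h
      exact absurd hc2 (not_le.2 (pow_lt_one₀ (radius_pos hn hc0).le h (by omega)))
    rw [← hc, if_pos hc0]
    have h1 : Measure.volumeIoiPow (n - 1) {r : Set.Ioi (0 : ℝ) | r.1 • ω.1 ∈ shiftedD n θ} ≤
        ENNReal.ofReal ((radius n c ^ n - 1) / n) := by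
      rw [← hcast]
      refine volumeIoiPow_le _ fun r hr => ?_
      have hr0 : (0 : ℝ) < r.1 := r.2
      rw [hn1]
      have := pow_add_one_le_pow hn hr0 (hrR r hr) hR1 (le_trans (by nlinarith) (hDr r hr).2)
      linarith
    have h2 : Measure.volumeIoiPow (n - 1) {r : Set.Ioi (0 : ℝ) | r.1 • ω.1 ∈ sector n θ} ≤
        ENNReal.ofReal (1 / n) := by
      rw [← hcast]
      refine volumeIoiPow_le _ fun r hr => ?_
      have hr0 : (0 : ℝ) < r.1 := r.2
      have := hr.2.1
      rw [norm_smul_sphere] at this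
      exact pow_le_one₀ hr0.le this.le
    refine (add_le_add h1 h2).trans ?_
    rw [← ENNReal.ofReal_add]
    · apply le_of_eq; congr 1; ring
    · have := one_le_pow₀ hR1 (n := n)
      exact div_nonneg (by linarith) hn0.le
    · positivity
  · have h2 : {r : Set.Ioi (0 : ℝ) | r.1 • ω.1 ∈ sector n θ} = ∅ := by
      refine Set.eq_empty_of_forall_notMem fun r hr => hcase ?_
      have hr0 : (0 : ℝ) < r.1 := r.2
      obtain ⟨h1, -, h3, h4⟩ := hr
      rw [norm_smul_sphere] at h3 h4
      simp only [PiLp.smul_apply, smul_eq_mul, ← hc] at h1 h3 h4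
      refine ⟨(mul_pos_iff_of_pos_left hr0).1 h1, ?_, ?_⟩
      · refine le_of_mul_le_mul_right ?_ hr0; linarith
      · refine le_of_mul_le_mul_right ?_ (pow_pos hr0 2); linarith
    rw [h2, measure_empty, add_zero, ← hc]
    split_ifs with hc0
    · rw [← hcast]
      refine volumeIoiPow_le _ fun r hr => ?_
      have hr0 : (0 : ℝ) < r.1 := r.2
      rw [hn1]
      exact pow_le_pow_left₀ hr0.le (hrR r hr) n
    · have : {r : Set.Ioi (0 : ℝ) | r.1 • ω.1 ∈ shiftedD n θ} = ∅ :=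
        Set.eq_empty_of_forall_notMem fun r hr => hc0 (hDr r hr).1
      rw [this, measure_empty]

theorem volume_shiftedD_add_sector_le (hn : 3 ≤ n) {θ : ℝ} (hθ : 0 ≤ θ) :
    volume (shiftedD n θ) + volume (sector n θ) ≤ volume (G n) := by
  have : Nontrivial (EuclideanSpace ℝ (Fin n)) :=
    Module.nontrivial_of_finrank_pos (R := ℝ) (by rw [finrank_euclideanSpace_fin]; omega)
  rw [volume_eq_lintegral_slice hn (measurableSet_shiftedD θ),
    volume_eq_lintegral_slice hn (measurableSet_sector θ),
    volume_eq_lintegral_slice hn measurableSet_G, ← lintegral_add_left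
      (measurable_volumeIoiPow_slice _ (measurableSet_shiftedD θ))]
  exact lintegral_mono fun ω => slice_add_slice_le hn hθ ω

/-- For `w = y - θe₁`, the bounds `s ≥ 2` and `κθ² ≤ 1` give `κθw₁ ≥ 1` and `w₁ ≥ θ`, hence `κw₁² ≥
1`, while `|w| < 1`. -/
theorem E_diff_D_subset (hn : 5 ≤ n) {θ : ℝ} (hθ : 0 ≤ θ)
    (hk : (2 * (n : ℝ) - 4) * θ ^ 2 ≤ 1) :
    E n θ \ D n θ ⊆ (fun y => y + -(θ • e₁ n)) ⁻¹' sector n θ := by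
  rintro y ⟨hyE, hyD⟩
  have hs := two_le_of_mem_E_diff_D hn hθ hk hyE hyD
  have ha := norm_sub_pos_of_mem_E hyE
  have ha1 := norm_sub_lt_one_of_mem_E (by omega) hθ hyE
  have hκ := kappa_pos (n := n) (by omega)
  simp only [Set.mem_preimage, sector, Set.mem_ofPred_eq, ← sub_eq_add_neg, sub_smul_e₁_zero]
  set κ := 2 * (n : ℝ) - 4
  have hθ0 : 0 < θ := by
    refine lt_of_le_of_ne hθ fun h => ?_
    rw [← h] at hs; linarith
  have h1 : 1 ≤ κ * θ * (y 0 - θ) := by nlinarith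
  have h2 : θ ≤ y 0 - θ := by
    have : 0 ≤ κ * θ * (y 0 - 2 * θ) := by nlinarith
    have := nonneg_of_mul_nonneg_right this (by positivity)
    linarith
  refine ⟨by linarith, ha1, by linarith, ?_⟩
  have h3 : κ * θ * (y 0 - θ) ≤ κ * (y 0 - θ) ^ 2 := by
    rw [sq, ← mul_assoc]
    gcongr
    linarith
  nlinarith

theorem volume_union_le_volume_G (hn : 5 ≤ n) {θ : ℝ} (hθ : 0 ≤ θ)
    (hk : (2 * (n : ℝ) - 4) * θ ^ 2 ≤ 1) : volume (E n θ ∪ D n θ) ≤ volume (G n) := by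
  have h1 : volume (E n θ \ D n θ) ≤ volume (sector n θ) := by
    rw [← measure_preimage_add_right volume (-(θ • e₁ n)) (sector n θ)]
    exact measure_mono (E_diff_D_subset hn hθ hk)
  calc volume (E n θ ∪ D n θ) = volume (D n θ ∪ E n θ \ D n θ) := by
        rw [Set.union_sdiff_self, Set.union_comm]
    _ ≤ volume (shiftedD n θ) + volume (sector n θ) := by
        refine (measure_union_le _ _).trans ?_
        rw [volume_D]
        gcongr
    _ ≤ volume (G n) := volume_shiftedD_add_sector_le (by omega) hθ

end

/-! ### A Gamma function inequality -/

theorem Gamma_add_le {x ε : ℝ} (hx : 0 < x) (hε : 0 < ε) (hε1 : ε < 1) :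
    Real.Gamma (x + ε) ≤ Real.Gamma x * x ^ ε := by
  have h := Real.Gamma_mul_add_mul_le_rpow_Gamma_mul_rpow_Gamma hx (by linarith : 0 < x + 1)
    (sub_pos.2 hε1) hε (by ring)
  have e : (1 - ε) * x + ε * (x + 1) = x + ε := by ring
  have hΓ := Real.Gamma_pos_of_pos hx
  rw [e, Real.Gamma_add_one hx.ne', Real.mul_rpow hx.le hΓ.le, mul_left_comm,
    ← Real.rpow_add hΓ, sub_add_cancel, Real.rpow_one, mul_comm] at h
  exact h

/-- This is `Gamma_add_le` started from `x - 1 + ε` with step `1 - ε`, followed by the functional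
equation. -/
theorem le_Gamma_add {x ε : ℝ} (hx : 1 < x) (hε : 0 < ε) (hε1 : ε < 1) :
    Real.Gamma x * (x - 1 + ε) ^ ε ≤ Real.Gamma (x + ε) := by
  have hy : 0 < x - 1 + ε := by linarith
  have h := Gamma_add_le hy (sub_pos.2 hε1) (by linarith)
  have e1 : x - 1 + ε + (1 - ε) = x := by ring
  have e2 : x + ε = (x - 1 + ε) + 1 := by ring
  rw [e1] at h
  rw [e2, Real.Gamma_add_one hy.ne']
  calc Real.Gamma x * (x - 1 + ε) ^ ε
      ≤ Real.Gamma (x - 1 + ε) * (x - 1 + ε) ^ (1 - ε) * (x - 1 + ε) ^ ε := by gcongr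
    _ = Real.Gamma (x - 1 + ε) * ((x - 1 + ε) ^ (1 - ε) * (x - 1 + ε) ^ ε) := mul_assoc _ _ _
    _ = _ := by rw [← Real.rpow_add hy, sub_add_cancel, Real.rpow_one, mul_comm]

theorem product_pow_le {M : ℕ} (hM : 3 ≤ M) :
    ((1 + 2 / (M : ℝ)) * ((1 + 4 / (3 * M)) * (1 + 4 / (5 * M)))) ^ M ≤
      ((10 * M + 8) / (M + 4)) ^ 2 := by
  obtain h12 | h12 := lt_or_ge M 12
  · interval_cases M <;> norm_num
  · have hM' : (12 : ℝ) ≤ M := by exact_mod_cast h12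
    have hM0 : (0 : ℝ) < M := by linarith
    have h1 : (1 + 2 / (M : ℝ)) * ((1 + 4 / (3 * M)) * (1 + 4 / (5 * M))) ≤
        Real.exp (62 / (15 * M)) := by
      have e : 62 / (15 * (M : ℝ)) = 2 / M + (4 / (3 * M) + 4 / (5 * M)) := by field_simp; norm_num
      have b (x : ℝ) : 1 + x ≤ Real.exp x := by rw [add_comm]; exact Real.add_one_le_exp x
      rw [e, Real.exp_add, Real.exp_add]
      gcongr <;> exact b _
    calc _ ≤ Real.exp (62 / (15 * M)) ^ M := by gcongr
      _ = Real.exp (31 / 15) ^ 2 := by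
        rw [← Real.exp_nat_mul, ← Real.exp_nat_mul]
        congr 1; push_cast; field_simp; norm_num
      _ ≤ _ := by
        -- The number 7.9 fits between `exp (31/15)` and the value 8 of the quotient at `M = 12`.
        have h2 : Real.exp (31 / 15) ≤ 7.9 := by
          refine le_of_pow_le_pow_left₀ (n := 15) (by norm_num) (by norm_num) ?_
          have e : Real.exp (31 / 15) ^ 15 = Real.exp 1 ^ 31 := by
            rw [← Real.exp_nat_mul, ← Real.exp_nat_mul]; norm_num
          rw [e]
          calc Real.exp 1 ^ 31 ≤ 2.7182818286 ^ 31 := by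
                gcongr; exact Real.exp_one_lt_d9.le
            _ ≤ _ := by norm_num
        gcongr
        refine h2.trans ?_
        rw [le_div_iff₀ (by linarith)]
        linarith

/-- With `ε = 2 / M`, log-convexity bounds the left Gamma value above from `M/2 + 2`, and `Γ(3/2 +
ε)` below from `7/2` through two functional equations. Since `Mε = 2`, taking `M`-th powers turns
the remaining inequality into `product_pow_le`. -/
theorem Gamma_quotient_bound {M : ℕ} (hM : 3 ≤ M) :
    2 * √Real.pi * Real.Gamma (M / 2 + 2 + 2 / M) ≤
      (2 * (M : ℝ)) ^ (1 + 2 / (M : ℝ)) * Real.Gamma (3 / 2 + 2 / M) *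
        Real.Gamma (M / 2 + 1) := by
  have hM3 : (3 : ℝ) ≤ M := by exact_mod_cast hM
  have hM0 : (0 : ℝ) < M := by linarith
  obtain ⟨ε, hε⟩ : ∃ ε, ε = 2 / (M : ℝ) := ⟨_, rfl⟩
  have hε0 : 0 < ε := by rw [hε]; positivity
  have hε1 : ε < 1 := by rw [hε, div_lt_one hM0]; linarith
  rw [← hε]
  have hpi : 0 < √Real.pi := Real.sqrt_pos.2 Real.pi_pos
  have hΓ : 0 < Real.Gamma (M / 2 + 1) := Real.Gamma_pos_of_pos (by positivity)
  have hup : Real.Gamma (M / 2 + 2 + ε) ≤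
      (M / 2 + 1) * Real.Gamma (M / 2 + 1) * (M / 2 + 2) ^ ε := by
    have h := Gamma_add_le (x := M / 2 + 2) (by positivity) hε0 hε1
    have e : (M / 2 + 2 : ℝ) = M / 2 + 1 + 1 := by ring
    calc _ ≤ _ := h
      _ = _ := by
        congr 1
        rw [e, Real.Gamma_add_one (by positivity)]
  have hlow : 3 / 4 * (5 / 2) * √Real.pi / 2 * 2 * (5 / 2 + ε) ^ ε ≤
      (5 / 2 + ε) * ((3 / 2 + ε) * Real.Gamma (3 / 2 + ε)) := by
    have h := le_Gamma_add (x := 7 / 2) (by norm_num) hε0 hε1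
    have e1 : Real.Gamma (7 / 2 + ε) = (5 / 2 + ε) * ((3 / 2 + ε) * Real.Gamma (3 / 2 + ε)) := by
      rw [show 7 / 2 + ε = 5 / 2 + ε + 1 by ring, Real.Gamma_add_one (by positivity),
        show 5 / 2 + ε = 3 / 2 + ε + 1 by ring, Real.Gamma_add_one (by positivity)]
    have e2 : Real.Gamma (7 / 2) = 3 / 4 * (5 / 2) * √Real.pi / 2 * 2 := by
      rw [show (7 / 2 : ℝ) = 1 / 2 + 1 + 1 + 1 by norm_num, Real.Gamma_add_one (by norm_num),
        Real.Gamma_add_one (by norm_num), Real.Gamma_add_one (by norm_num),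
        Real.Gamma_one_half_eq]
      ring
    rw [e1, e2, show (7 / 2 - 1 + ε : ℝ) = 5 / 2 + ε by ring] at h
    exact h
  have hY : (1 + ε) * ((1 + 2 * ε / 3) * (1 + 2 * ε / 5)) ≤
      (2 * M * (5 / 2 + ε) / (M / 2 + 2)) ^ ε := by
    have h := product_pow_le hM
    have eY : (10 * M + 8) / (M + 4 : ℝ) = 2 * M * (5 / 2 + ε) / (M / 2 + 2) := by
      rw [hε]; field_simp; ring
    have eP : (1 + 2 / (M : ℝ)) * ((1 + 4 / (3 * M)) * (1 + 4 / (5 * M))) =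
        (1 + ε) * ((1 + 2 * ε / 3) * (1 + 2 * ε / 5)) := by
      rw [hε]; field_simp; ring
    rw [eY, eP] at h
    refine le_of_pow_le_pow_left₀ (n := M) (by omega) (by positivity) (h.trans (le_of_eq ?_))
    rw [← Real.rpow_natCast, ← Real.rpow_natCast, ← Real.rpow_mul (by positivity)]
    congr 1
    rw [hε]; field_simp; norm_num
  rw [Real.div_rpow (by positivity) (by positivity), le_div_iff₀ (by positivity),
    Real.mul_rpow (by positivity) (by positivity)] at hY
  rw [Real.rpow_add (by positivity), Real.rpow_one]
  have hMε : M * ε = 2 := by rw [hε]; field_simp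
  set K := (2 * (M : ℝ)) ^ ε with hK
  set L := (M / 2 + 2 : ℝ) ^ ε with hL
  set J := (5 / 2 + ε) ^ ε
  set g := Real.Gamma (3 / 2 + ε)
  have hK0 : 0 < K := by positivity
  have hL0 : 0 < L := by positivity
  have hg0 : 0 < g := Real.Gamma_pos_of_pos (by positivity)
  have key : √Real.pi * (M + 2) * L ≤ 2 * M * K * g := by
    have hP : 0 < (5 / 2 + ε) * (3 / 2 + ε) := by positivity
    refine le_of_mul_le_mul_left ?_ hP
    have h1 := mul_le_mul_of_nonneg_left hlow (by positivity : 0 ≤ 2 * M * K)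
    have h2 := mul_le_mul_of_nonneg_left hY (by positivity : 0 ≤ 15 / 4 * √Real.pi * M)
    have e3 : M * (1 + ε) = M + 2 := by rw [mul_add, hMε]; ring
    calc (5 / 2 + ε) * (3 / 2 + ε) * (√Real.pi * (M + 2) * L)
        = 15 / 4 * √Real.pi * M * ((1 + ε) * ((1 + 2 * ε / 3) * (1 + 2 * ε / 5)) * L) := by
          rw [← e3]; ring
      _ ≤ _ := h2
      _ = 2 * M * K * (3 / 4 * (5 / 2) * √Real.pi / 2 * 2 * J) := by ring
      _ ≤ _ := h1
      _ = _ := by ring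
  calc 2 * √Real.pi * Real.Gamma (M / 2 + 2 + ε)
      ≤ 2 * √Real.pi * ((M / 2 + 1) * Real.Gamma (M / 2 + 1) * L) := by gcongr
    _ = √Real.pi * (M + 2) * L * Real.Gamma (M / 2 + 1) := by ring
    _ ≤ 2 * M * K * g * Real.Gamma (M / 2 + 1) := by gcongr

/-! ### The volume of `G n` -/

section Polar

open Measure Module

variable {E : Type*} [NormedAddCommGroup E] [NormedSpace ℝ E] [MeasurableSpace E] [BorelSpace E]
  [FiniteDimensional ℝ E] [Nontrivial E]

theorem lintegral_eq_lintegral_toSphere (μ : Measure E) [μ.IsAddHaarMeasure] {f : E → ENNReal}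
    (hf : Measurable f) :
    ∫⁻ x, f x ∂μ = ∫⁻ ω, ∫⁻ r, f (r.1 • ω.1) ∂volumeIoiPow (finrank ℝ E - 1) ∂μ.toSphere := by
  have hm : Measurable fun p : Metric.sphere (0 : E) 1 × Set.Ioi (0 : ℝ) => f (p.2.1 • p.1.1) :=
    hf.comp (by fun_prop)
  rw [← lintegral_prod _ hm.aemeasurable,
    ← (μ.measurePreserving_homeomorphUnitSphereProd).lintegral_comp hm,
    ← restrict_compl_singleton (μ := μ) 0,
    ← lintegral_subtype_comap (measurableSet_singleton _).compl]
  · rw [restrict_compl_singleton]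
    refine lintegral_congr fun x => ?_
    simp only [homeomorphUnitSphereProd_apply_fst_coe, homeomorphUnitSphereProd_apply_snd_coe]
    rw [smul_smul, mul_inv_cancel₀ (norm_ne_zero_iff.2 x.2), one_smul]

theorem integrableOn_rpow_mul_exp_neg_sq {p : ℝ} (hp : 0 ≤ p) :
    IntegrableOn (fun t : ℝ => t ^ p * Real.exp (-t ^ 2)) (Set.Ioi 0) := by
  have h := integrableOn_rpow_mul_exp_neg_rpow (p := 2) (s := p) (by linarith) (by norm_num)
  simpa only [Real.rpow_two] using h

theorem setIntegral_rpow_mul_exp_neg_sq {p : ℝ} (hp : 0 ≤ p) :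
    ∫ t in Set.Ioi (0 : ℝ), t ^ p * Real.exp (-t ^ 2) = 1 / 2 * Real.Gamma ((p + 1) / 2) := by
  have h := integral_rpow_mul_exp_neg_rpow (p := 2) (q := p) (by norm_num) (by linarith)
  simpa only [Real.rpow_two] using h

theorem lintegral_volumeIoiPow_rpow_mul_exp {p : ℝ} (hp : 0 ≤ p) (k : ℕ) :
    ∫⁻ r : Set.Ioi (0 : ℝ), ENNReal.ofReal (r.1 ^ p * Real.exp (-r.1 ^ 2)) ∂volumeIoiPow k =
      ENNReal.ofReal (1 / 2 * Real.Gamma ((p + k + 1) / 2)) := by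
  rw [volumeIoiPow, lintegral_withDensity_eq_lintegral_mul _ (by fun_prop) (by fun_prop)]
  have h0 : 0 ≤ p + k := by positivity
  rw [← setIntegral_rpow_mul_exp_neg_sq h0, ofReal_integral_eq_lintegral_ofReal
    (integrableOn_rpow_mul_exp_neg_sq h0)]
  · rw [← lintegral_subtype_comap measurableSet_Ioi]
    refine lintegral_congr fun r => ?_
    have hr : (0 : ℝ) < r.1 := r.2
    rw [Pi.mul_apply, ← ENNReal.ofReal_mul (by positivity), Real.rpow_add hr, Real.rpow_natCast]
    congr 1; ring
  · filter_upwards [ae_restrict_mem measurableSet_Ioi] with t ht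
    have ht' : (0 : ℝ) < t := ht
    positivity

end Polar

section

variable {n : ℕ} [NeZero n]

/-- The function equal to `y₁ ^ p * exp (-|y|²)` on the half-space `y₁ > 0`, and to `0` elsewhere. -/
noncomputable def gaussianMoment (n : ℕ) [NeZero n] (p : ℝ) (y : EuclideanSpace ℝ (Fin n)) : ℝ :=
  if 0 < y 0 then y 0 ^ p * Real.exp (-‖y‖ ^ 2) else 0

theorem gaussianMoment_nonneg (p : ℝ) (y : EuclideanSpace ℝ (Fin n)) : 0 ≤ gaussianMoment n p y := by
  unfold gaussianMoment
  split_ifs <;> positivity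

theorem measurable_gaussianMoment (p : ℝ) : Measurable (gaussianMoment n p) := by
  unfold gaussianMoment
  refine Measurable.ite (measurableSet_lt (by fun_prop) (by fun_prop)) (by fun_prop) (by fun_prop)

/-- The factors of `gaussianMoment`. -/
noncomputable def gaussianFactor (n : ℕ) [NeZero n] (p : ℝ) (i : Fin n) : ℝ → ℝ :=
  if i = 0 then (Set.Ioi 0).indicator fun t => t ^ p * Real.exp (-t ^ 2)
  else fun t => Real.exp (-t ^ 2)

theorem gaussianMoment_eq_prod (p : ℝ) (y : EuclideanSpace ℝ (Fin n)) :
    gaussianMoment n p y = ∏ i, gaussianFactor n p i (y i) := by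
  have h1 : ∏ i, gaussianFactor n p i (y i) =
      ∏ i, ((if i = 0 then (if 0 < y 0 then y 0 ^ p else 0) else 1) * Real.exp (-(y i) ^ 2)) := by
    refine Finset.prod_congr rfl fun i _ => ?_
    unfold gaussianFactor
    split_ifs with hi h0
    · subst hi; simp [Set.indicator, h0]
    · subst hi; simp [Set.indicator, h0]
    · simp
  rw [h1, Finset.prod_mul_distrib, Finset.prod_ite_eq' Finset.univ (0 : Fin n), ← Real.exp_sum,
    if_pos (Finset.mem_univ _), gaussianMoment, EuclideanSpace.real_norm_sq_eq,
    Finset.sum_neg_distrib]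
  split_ifs <;> simp

theorem integrable_gaussianFactor {p : ℝ} (hp : 0 ≤ p) (i : Fin n) :
    Integrable (gaussianFactor n p i) := by
  unfold gaussianFactor
  split_ifs
  · rw [integrable_indicator_iff measurableSet_Ioi]
    exact integrableOn_rpow_mul_exp_neg_sq hp
  · simpa using integrable_exp_neg_mul_sq (b := 1) one_pos

theorem integral_gaussianFactor {p : ℝ} (hp : 0 ≤ p) (i : Fin n) :
    ∫ t, gaussianFactor n p i t =
      (if i = 0 then 1 / 2 * Real.Gamma ((p + 1) / 2) / √Real.pi else 1) * √Real.pi := by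
  have hpi : √Real.pi ≠ 0 := (Real.sqrt_pos.2 Real.pi_pos).ne'
  unfold gaussianFactor
  split_ifs
  · rw [integral_indicator measurableSet_Ioi, setIntegral_rpow_mul_exp_neg_sq hp,
      div_mul_cancel₀ _ hpi]
  · simpa using integral_gaussian 1

theorem lintegral_gaussianMoment {p : ℝ} (hp : 0 ≤ p) :
    ∫⁻ y, ENNReal.ofReal (gaussianMoment n p y) =
      ENNReal.ofReal (1 / 2 * Real.Gamma ((p + 1) / 2) / √Real.pi * √Real.pi ^ n) := by
  have e := (PiLp.volume_preserving_toLp (Fin n)).lintegral_comp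
    (measurable_gaussianMoment (n := n) p).ennreal_ofReal
  rw [← e]
  simp only [gaussianMoment_eq_prod]
  rw [← ofReal_integral_eq_lintegral_ofReal]
  · rw [integral_fintype_prod_volume_eq_prod]
    simp only [integral_gaussianFactor hp]
    rw [Finset.prod_mul_distrib, Finset.prod_ite_eq' Finset.univ (0 : Fin n),
      if_pos (Finset.mem_univ _)]
    simp
  · exact Integrable.fintype_prod fun i => integrable_gaussianFactor hp i
  · refine Filter.Eventually.of_forall fun y => ?_
    rw [Pi.zero_apply]
    have := gaussianMoment_nonneg (n := n) p (WithLp.toLp 2 y)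
    rwa [gaussianMoment_eq_prod] at this

/-- The `p`-th moment of the first coordinate over a half-sphere. -/
noncomputable def sphereMoment (n : ℕ) [NeZero n] (p : ℝ) : ENNReal :=
  ∫⁻ ω : Metric.sphere (0 : EuclideanSpace ℝ (Fin n)) 1,
    (if 0 < ω.1 0 then ENNReal.ofReal (ω.1 0 ^ p) else 0)
      ∂(volume : Measure (EuclideanSpace ℝ (Fin n))).toSphere

/-- The Gaussian moment is computed twice: in polar coordinates it is the sphere moment times a
radial Gamma integral, in Cartesian ones a product of one-dimensional integrals. -/
theorem sphereMoment_mul (hn : 3 ≤ n) {p : ℝ} (hp : 0 ≤ p) :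
    sphereMoment n p * ENNReal.ofReal (1 / 2 * Real.Gamma ((p + n) / 2)) =
      ENNReal.ofReal (1 / 2 * Real.Gamma ((p + 1) / 2) / √Real.pi * √Real.pi ^ n) := by
  have : Nontrivial (EuclideanSpace ℝ (Fin n)) :=
    Module.nontrivial_of_finrank_pos (R := ℝ) (by rw [finrank_euclideanSpace_fin]; omega)
  have hcast : p + (n - 1 : ℕ) + 1 = p + n := by rw [Nat.cast_pred (by omega)]; ring
  rw [← lintegral_gaussianMoment hp, lintegral_eq_lintegral_toSphere volume
    (measurable_gaussianMoment (n := n) p).ennreal_ofReal, finrank_euclideanSpace_fin, sphereMoment,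
    ← hcast, ← lintegral_volumeIoiPow_rpow_mul_exp hp, ← lintegral_mul_const]
  · refine lintegral_congr fun ω => ?_
    rw [← lintegral_const_mul _ (by fun_prop)]
    refine lintegral_congr fun r => ?_
    have hr : (0 : ℝ) < r.1 := r.2
    rw [gaussianMoment, norm_smul_sphere]
    simp only [PiLp.smul_apply, smul_eq_mul, mul_pos_iff_of_pos_left hr]
    split_ifs with h
    · rw [← ENNReal.ofReal_mul (by positivity), Real.mul_rpow hr.le h.le]
      congr 1; ring
    · simp
  · refine Measurable.ite (measurableSet_lt (by fun_prop) (by fun_prop)) (by fun_prop) (by fun_prop)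

theorem volume_G_eq (hn : 3 ≤ n) :
    volume (G n) = ENNReal.ofReal ((2 * (n : ℝ) - 4) ^ ((n : ℝ) / (n - 2 : ℕ)) / n) *
      sphereMoment n (2 * ((n : ℝ) / (n - 2 : ℕ))) := by
  have hκ := kappa_pos hn
  rw [volume_eq_lintegral_slice hn measurableSet_G, sphereMoment, ← lintegral_const_mul]
  · refine lintegral_congr fun ω => ?_
    rw [volumeIoiPow_slice_G hn]
    split_ifs with h
    · rw [← ENNReal.ofReal_mul (by positivity)]
      congr 1
      rw [radius, ← Real.rpow_natCast, ← Real.rpow_mul (by positivity), inv_mul_eq_div,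
        Real.mul_rpow hκ.le (by positivity), ← Real.rpow_natCast (ω.1 0) 2,
        ← Real.rpow_mul h.le]
      push_cast
      ring
    · simp
  · refine Measurable.ite (measurableSet_lt (by fun_prop) (by fun_prop)) (by fun_prop) (by fun_prop)

theorem volume_ball_le_volume_G (hn : 5 ≤ n) : volume (B n) ≤ volume (G n) := by
  have hn0 : (0 : ℝ) < n := by exact_mod_cast (by omega : 0 < n)
  obtain ⟨M, rfl⟩ := Nat.exists_eq_add_of_le' (by omega : 2 ≤ n)
  have hM : 3 ≤ M := by omega
  have hM0 : (0 : ℝ) < M := by exact_mod_cast (by omega : 0 < M)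
  rw [B, EuclideanSpace.volume_ball, volume_G_eq (by omega)]
  simp only [Nat.add_sub_cancel, Fintype.card_fin, ENNReal.ofReal_one, one_pow, one_mul]
  obtain ⟨q, hq⟩ : ∃ q : ℝ, q = ((M + 2 : ℕ) : ℝ) / M := ⟨_, rfl⟩
  have hq' : q = 1 + 2 / (M : ℝ) := by rw [hq]; push_cast; field_simp
  have hq0 : 0 ≤ q := by rw [hq']; positivity
  rw [← hq]
  have hmul := sphereMoment_mul (n := M + 2) (by omega) (p := 2 * q) (by positivity)
  have e1 : (2 * q + (M + 2 : ℕ)) / 2 = M / 2 + 2 + 2 / (M : ℝ) := by rw [hq']; push_cast; ring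
  have e2 : (2 * q + 1) / 2 = 3 / 2 + 2 / (M : ℝ) := by rw [hq']; ring
  have e3 : 2 * ((M + 2 : ℕ) : ℝ) - 4 = 2 * M := by push_cast; ring
  have e4 : ((M + 2 : ℕ) : ℝ) / 2 + 1 = (M / 2 + 1) + 1 := by push_cast; ring
  rw [e1, e2] at hmul
  rw [e3, e4, Real.Gamma_add_one (by positivity)]
  have key := Gamma_quotient_bound hM
  rw [← hq'] at key
  have hg1 : 0 < Real.Gamma (M / 2 + 2 + 2 / M) := Real.Gamma_pos_of_pos (by positivity)
  have hg2 : 0 < Real.Gamma (M / 2 + 1) := Real.Gamma_pos_of_pos (by positivity)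
  set g1 := Real.Gamma (M / 2 + 2 + 2 / M)
  set g2 := Real.Gamma (M / 2 + 1)
  set g3 := Real.Gamma (3 / 2 + 2 / M)
  have hpi : 0 < √Real.pi := Real.sqrt_pos.2 Real.pi_pos
  have hc : 0 < 1 / 2 * g1 := by positivity
  -- Scaling by the radial Gamma factor lets `hmul` eliminate the sphere moment without division in
  -- `ENNReal`.
  refine (ENNReal.mul_le_mul_iff_left (c := ENNReal.ofReal (1 / 2 * g1)) ?_ ?_).1 ?_
  · exact (ENNReal.ofReal_pos.2 hc).ne'
  · exact ENNReal.ofReal_ne_top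
  · rw [mul_assoc, hmul, ← ENNReal.ofReal_mul (by positivity), ← ENNReal.ofReal_mul (by positivity)]
    apply ENNReal.ofReal_le_ofReal
    set P := √Real.pi ^ (M + 2)
    have hP : 0 < P := by positivity
    set K := (2 * (M : ℝ)) ^ q
    simp only [Nat.cast_add, Nat.cast_ofNat]
    rw [div_mul_eq_mul_div P, div_mul_eq_mul_div K, div_le_div_iff₀ (by positivity) (by positivity)]
    have e5 : P * (1 / 2 * g1) * (M + 2) = P * (M + 2) / (4 * √Real.pi) * (2 * √Real.pi * g1) := by
      field_simp; ring
    have e6 : K * (1 / 2 * g3 / √Real.pi * P) * ((M / 2 + 1) * g2) =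
        P * (M + 2) / (4 * √Real.pi) * (K * g3 * g2) := by
      field_simp; ring
    rw [e5, e6]
    gcongr

end

end LevelSets

/-! ### Assembly of the cases -/

theorem proposition14 (n : ℕ) [NeZero n] (hn : 3 ≤ n) (θ : ℝ) (hθ : θ ∈ Set.Icc (0 : ℝ) 1) :
    ((n = 3 ∨ n = 4) →
      volume (LevelSets.E n θ ∪ LevelSets.D n θ) ≤ volume (LevelSets.B n)) ∧
    (5 ≤ n →
      volume (LevelSets.E n θ ∪ LevelSets.D n θ) ≤ volume (LevelSets.G n)) := by
  have ball {c : EuclideanSpace ℝ (Fin n)}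
      (h : LevelSets.E n θ ∪ LevelSets.D n θ ⊆ Metric.closedBall c 1) :
      volume (LevelSets.E n θ ∪ LevelSets.D n θ) ≤ volume (LevelSets.B n) := by
    refine (measure_mono h).trans_eq ?_
    have : Nonempty (Fin n) := ⟨0⟩
    rw [EuclideanSpace.volume_closedBall, LevelSets.B, EuclideanSpace.volume_ball]
  have pos (h : 1 ≤ (2 * (n : ℝ) - 4) * θ ^ 2) : 0 < θ := by
    refine lt_of_le_of_ne hθ.1 fun h0 => ?_
    rw [← h0] at h; norm_num at h
  refine ⟨?_, fun hn5 => ?_⟩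
  · rintro (rfl | rfl)
    · obtain ⟨c, hc⟩ := LevelSets.union_subset_closedBall_three hθ.1
      exact ball (by convert hc)
    · obtain h | h := le_total 1 ((2 * ((4 : ℕ) : ℝ) - 4) * θ ^ 2)
      · exact ball (LevelSets.union_subset_closedBall le_rfl (pos h) h)
      · refine ball (c := (1 - θ) • LevelSets.e₁ 4) ?_
        have hD := LevelSets.D_subset_closedBall_of_le_four (n := 4) (Or.inr rfl) hθ.1
        exact Set.union_subset ((LevelSets.E_subset_D_four hθ.1 (by norm_num at h; linarith)).trans
          hD) hD
  · obtain h | h := le_total 1 ((2 * (n : ℝ) - 4) * θ ^ 2)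
    · exact (ball (LevelSets.union_subset_closedBall (by omega) (pos h) h)).trans
        (LevelSets.volume_ball_le_volume_G hn5)
    · exact LevelSets.volume_union_le_volume_G hn5 hθ.1 h
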